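/- For $n\ge 2$ let $\mathcal A_n=\{0,\dots,n-1\}$ and let $\mathfrak C_n=\mathcal A_n^{\mathbb N}$ be the Cantor space of infinite words, with the product topology. A finite set $P\subset\mathcal A_n^*$ of finite words is a (complete) prefix code if every $\zeta\in\mathfrak C_n$ has exactly one element of $P$ as a prefix. A permutation $\sigma\in\operatorname{Sym}(n)$ acts on words letter by letter. For $H\le\operatorname{Sym}(n)$, the symmetric Thompson group $V_n(H)$ is the group, under composition, of all homeomorphisms $v$ of $\mathfrak C_n$ for which there are prefix codes $\{p_1,\dots,p_l\}$ and $\{q_1,\dots,q_l\}$ (each with $l$ distinct elements) and $\sigma_i,\tau_i\in H$ such that $v(p_i\,\sigma_i(u))=q_i\,\tau_i(u)$ for all $i$ and all $u\in\mathfrak C_n$. **Theorem.** Let $m\ge 2$ and $k\ge 1$ be natural numbers, let $n=k(m-1)+m$, and let $G\le\operatorname{Sym}(m)$. Let $H=G_{ext}\le\operatorname{Sym}(n)$ be the group of those permutations of $\mathcal A_n$ that act on the first $m$ letters $0,\dots,m-1$ as some element of $G$ and fix the remaining $n-m$ letters. Then $V_m(G)$ embeds in $V_n(H)$: there is an injective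 group homomorphism $\varphi:V_m(G)\to V_n(H)$. Moreover, $\varphi$ can be chosen not to arise from a topological conjugacy, that is, so that there is no homeomorphism $h:\mathfrak C_m\to\mathfrak C_n$ with $\varphi(g)=h\circ g\circ h^{-1}$ for all $g\in V_m(G)$. -/

import Mathlib

namespace SymThompson

/-- The alphabet `{0, …, n-1}`. -/
abbrev Letter (n : ℕ) : Type := Fin n

/-- Finite words, including the empty word. -/
abbrev Word (n : ℕ) : Type := List (Letter n)

/-- The `n`-adic Cantor space: infinite words, with the product topology (letters are discrete). -/
abbrev Cantor (n : ℕ) : Type := ℕ → Letter n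

/-- Concatenation of a finite word with an infinite word. -/
def cat {n : ℕ} : Word n → Cantor n → Cantor n
  | [], u => u
  | a :: w, u => fun i => Nat.casesOn i a (cat w u)

/-- `p` is a prefix of the infinite word `ζ`. -/
def IsPrefixOf {n : ℕ} (p : Word n) (ζ : Cantor n) : Prop :=
  ∃ u : Cantor n, ζ = cat p u

/-- The finite list of words `p` enumerates, without repetition, a (complete) prefix code:
every infinite word has exactly one of them as a prefix. -/
def IsPrefixCode {n l : ℕ} (p : Fin l → Word n) : Prop :=
  ∀ ζ : Cantor n, ∃! i : Fin l, IsPrefixOf (p i) ζ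

/-- A table with four rows `p, σ, q, τ`; the rows `p` and `q` are prefix codes, and the
permutations `σ i`, `τ i` belong to `H`. -/
structure Table (n : ℕ) (H : Subgroup (Equiv.Perm (Letter n))) where
  len : ℕ
  p : Fin len → Word n
  σ : Fin len → Equiv.Perm (Letter n)
  q : Fin len → Word n
  τ : Fin len → Equiv.Perm (Letter n)
  code_p : IsPrefixCode p
  code_q : IsPrefixCode q
  σ_mem : ∀ i, σ i ∈ H
  τ_mem : ∀ i, τ i ∈ H

/-- The table `T` describes the homeomorphism `f`: `p i ‖ σ i (u) ↦ q i ‖ τ i (u)` for every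
column `i` and every infinite word `u`, where a permutation acts letter by letter. -/
def Table.Describes {n : ℕ} {H : Subgroup (Equiv.Perm (Letter n))} (T : Table n H)
    (f : Cantor n ≃ₜ Cantor n) : Prop :=
  ∀ (i : Fin T.len) (u : Cantor n), f (cat (T.p i) (T.σ i ∘ u)) = cat (T.q i) (T.τ i ∘ u)

section Closure

variable {n : ℕ} {H : Subgroup (Equiv.Perm (Letter n))}

theorem cat_append (v w : Word n) (u : Cantor n) : cat (v ++ w) u = cat v (cat w u) := by
  induction v with
  | nil => rfl
  | cons a v ih => simp only [List.cons_append, cat, ih]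

theorem comp_cat (τ : Equiv.Perm (Letter n)) (w : Word n) (u : Cantor n) :
    τ ∘ cat w u = cat (w.map τ) (τ ∘ u) := by
  induction w with
  | nil => rfl
  | cons a w ih =>
    funext i
    cases i with
    | zero => rfl
    | succ i => exact congrFun ih i

theorem cat_cons_inj {a b : Letter n} {v w : Word n} {u z : Cantor n}
    (h : cat (a :: v) u = cat (b :: w) z) : a = b ∧ cat v u = cat w z :=
  ⟨congrFun h 0, funext fun i => congrFun h (i + 1)⟩

theorem prefix_of_cat_eq {v w : Word n} {u z : Cantor n} (h : cat v u = cat w z)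
    (hl : v.length ≤ w.length) : ∃ t, w = v ++ t := by
  induction v generalizing w with
  | nil => exact ⟨w, rfl⟩
  | cons a v ih =>
    cases w with
    | nil => simp at hl
    | cons b w =>
      obtain ⟨rfl, h'⟩ := cat_cons_inj h
      obtain ⟨t, rfl⟩ := ih h' (by simpa using hl)
      exact ⟨t, rfl⟩

theorem exists_cat (N : ℕ) (ζ : Cantor n) : ∃ w : Word n, w.length = N ∧ ∃ u, ζ = cat w u := by
  induction N generalizing ζ with
  | zero => exact ⟨[], rfl, ζ, rfl⟩
  | succ N ih =>
    obtain ⟨w, hw, u, hu⟩ := ih fun i => ζ (i + 1)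
    refine ⟨ζ 0 :: w, by simp [hw], u, funext fun i => ?_⟩
    cases i with
    | zero => rfl
    | succ i => exact congrFun hu i

theorem describes_iff (f : Cantor n ≃ₜ Cantor n) :
    (∃ T : Table n H, T.Describes f) ↔
      ∃ N : ℕ, ∀ w : Word n, w.length = N →
        ∃ q : Word n, ∃ τ ∈ H, ∀ u, f (cat w u) = cat q (τ ∘ u) := by
  constructor
  · rintro ⟨T, hT⟩
    refine ⟨∑ i, (T.p i).length, fun w hw => ?_⟩
    by_cases hne : Nonempty (Cantor n)
    · obtain ⟨u₀⟩ := hne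
      obtain ⟨i, ⟨z, hz⟩, -⟩ := T.code_p (cat w u₀)
      have hle : (T.p i).length ≤ w.length := by
        rw [hw]
        exact Finset.single_le_sum (f := fun i => (T.p i).length) (fun _ _ => Nat.zero_le _)
          (Finset.mem_univ i)
      obtain ⟨t, rfl⟩ := prefix_of_cat_eq hz.symm hle
      refine ⟨T.q i ++ t.map (T.τ i * (T.σ i)⁻¹), T.τ i * (T.σ i)⁻¹,
        H.mul_mem (T.τ_mem i) (H.inv_mem (T.σ_mem i)), fun u => ?_⟩
      have h := hT i (⇑(T.σ i)⁻¹ ∘ cat t u)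
      have e : T.σ i ∘ (⇑(T.σ i)⁻¹ ∘ cat t u) = cat t u := by
        funext j; simp
      rw [e] at h
      rw [cat_append, h, cat_append, ← comp_cat]
      rfl
    · exact ⟨[], 1, H.one_mem, fun u => (hne ⟨u⟩).elim⟩
  · rintro ⟨N, hN⟩
    let e := Fintype.equivFin (List.Vector (Letter n) N)
    choose q τ hτ hf using fun w : List.Vector (Letter n) N => hN w.1 w.2
    have hcode : ∀ ζ : Cantor n, ∃ w : List.Vector (Letter n) N, IsPrefixOf w.1 ζ ∧
        ∀ v : List.Vector (Letter n) N, IsPrefixOf v.1 ζ → v = w := by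
      intro ζ
      obtain ⟨w, hw, u, hu⟩ := exists_cat N ζ
      refine ⟨⟨w, hw⟩, ⟨u, hu⟩, ?_⟩
      rintro ⟨v, hv⟩ ⟨z, hz⟩
      obtain ⟨t, ht⟩ := prefix_of_cat_eq (hz.symm.trans hu) (by simp [hv, hw])
      apply Subtype.ext
      have : t = [] := by
        have := congrArg List.length ht
        simp [hv, hw] at this
        exact this
      simp [ht, this]
    refine ⟨{ len := _, p := fun i => (e.symm i).1, σ := fun _ => 1, q := fun i => q (e.symm i),
              τ := fun i => τ (e.symm i), code_p := ?_, code_q := ?_,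
              σ_mem := fun _ => H.one_mem, τ_mem := fun i => hτ _ }, ?_⟩
    · intro ζ
      obtain ⟨w, hw, huniq⟩ := hcode ζ
      refine ⟨e w, by simpa using hw, fun i hi => ?_⟩
      rw [← huniq _ hi, Equiv.apply_symm_apply]
    · intro ζ
      obtain ⟨w, ⟨u, hu⟩, huniq⟩ := hcode (f.symm ζ)
      refine ⟨e w, ⟨τ w ∘ u, ?_⟩, ?_⟩
      · simp only [Equiv.symm_apply_apply]
        rw [← hf, ← hu, Homeomorph.apply_symm_apply]
      · rintro i ⟨z, hz⟩
        have : e.symm i = w := by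
          apply huniq
          refine ⟨⇑(τ (e.symm i))⁻¹ ∘ z, ?_⟩
          rw [Homeomorph.symm_apply_eq, hf, hz]
          congr 1
          funext j; simp
        rw [← this, Equiv.apply_symm_apply]
    · intro i u
      exact hf (e.symm i) u

end Closure

/-- The symmetric Thompson group `V_n(H)`: all homeomorphisms of the Cantor space that are
described by some table, under composition. -/
def V (n : ℕ) (H : Subgroup (Equiv.Perm (Letter n))) : Subgroup (Cantor n ≃ₜ Cantor n) where
  carrier := {f | ∃ T : Table n H, T.Describes f}
  one_mem' := by
    rw [Set.mem_ofPred_eq, describes_iff]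
    exact ⟨0, fun w _ => ⟨w, 1, H.one_mem, fun u => rfl⟩⟩
  mul_mem' := by
    intro g f hg hf
    rw [Set.mem_ofPred_eq, describes_iff] at hg hf ⊢
    obtain ⟨N₂, hg⟩ := hg
    obtain ⟨N₁, hf⟩ := hf
    refine ⟨N₁ + N₂, fun w hw => ?_⟩
    obtain ⟨q, τ, hτ, hq⟩ := hf (w.take N₁) (by simp [hw])
    have hlen : N₂ ≤ (q ++ (w.drop N₁).map τ).length := by simp [hw]
    obtain ⟨q', τ', hτ', hq'⟩ := hg ((q ++ (w.drop N₁).map τ).take N₂) (by simp [hw])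
    refine ⟨q' ++ ((q ++ (w.drop N₁).map τ).drop N₂).map τ', τ' * τ, H.mul_mem hτ' hτ,
      fun u => ?_⟩
    have h1 : f (cat w u) = cat (q ++ (w.drop N₁).map τ) (τ ∘ u) := by
      conv_lhs => rw [← List.take_append_drop N₁ w]
      rw [cat_append, hq, comp_cat, cat_append]
    rw [Homeomorph.mul_apply, h1]
    conv_lhs => rw [← List.take_append_drop N₂ (q ++ (w.drop N₁).map τ)]
    rw [cat_append, hq', comp_cat, cat_append]
    rfl
  inv_mem' := by
    rintro f ⟨T, hT⟩
    refine ⟨⟨T.len, T.q, T.τ, T.p, T.σ, T.code_q, T.code_p, T.τ_mem, T.σ_mem⟩, fun i u => ?_⟩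
    change f.symm _ = _
    rw [Homeomorph.symm_apply_eq]
    exact (hT i u).symm

/-- The extended group `G_ext ≤ Sym(n)` of `G ≤ Sym(m)`, for `m ≤ n`: each element of `G` acts on
the first `m` letters as it does in `Sym(m)`, and fixes the remaining `n - m` letters. -/
noncomputable def extGroup {m n : ℕ} (hmn : m ≤ n) (G : Subgroup (Equiv.Perm (Letter m))) :
    Subgroup (Equiv.Perm (Letter n)) :=
  G.map (Equiv.Perm.viaEmbeddingHom (Fin.castLEEmb hmn))

end SymThompson

/-! A set `X` that is a disjoint union of copies of itself indexed by the letters of `A`, compatibly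
with an action of `Sym(A)`, carries an action of `V_m(G)` for `A = {0, …, m-1}`: where the
homeomorphism `f` is `w u ↦ q τ(u)`, move the copy of `X` at `w` to the copy at `q` through `τ`. The
action is faithful because `w`, `q` and `τ` can be read off from it.

Let `A` be embedded in the alphabet of `ℭ_n`. The clopen set of words `b t …` with `b` in `A` and
`t ≠ b` is such an `X`. Its copy with index `c` consists of the words `c t …` with `t ≠ c`, and is
obtained by inserting at most one letter. Prepending `c` sends the words of `X` not starting with
`c` onto the words `c b t …` with `b` in `A`, `b ≠ c` and `t ≠ b`. The words `c t …` with `t`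
outside `A` can stay where they are, and the remaining `c t …` go to `c t t …`, which are exactly
the ones still missing. Only prefixes are changed, so the action on `X`, extended by the identity,
is by elements of `V_n(H)`. Since `V_m(G)` has no global fixed point in `ℭ_m` while every point
outside of `X` is fixed, no homeomorphism `ℭ_m → ℭ_n` intertwines the actions. -/

namespace SymThompson

open Equiv (Perm)

/-- A set `X` identified with the disjoint union of copies of itself indexed by the letters of `A`,
so that `Sym(A)` permutes the copies and acts inside each of them as it does on `X`. -/
structure SelfSimilar (A X : Type*) [MulAction (Perm A) X] where
  branch : A × X ≃ X
  smul_branch (τ : Perm A) (c : A) (x : X) : τ • branch (c, x) = branch (τ c, τ • x)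

namespace SelfSimilar

variable {A X Y : Type*} [MulAction (Perm A) X] [MulAction (Perm A) Y]
  (S : SelfSimilar A X) (T : SelfSimilar A Y)

/-- The embedding of `X` onto its copy indexed by the finite word `w`. -/
def cone (w : List A) (x : X) : X := w.foldr (fun c y => S.branch (c, y)) x

theorem cone_nil (x : X) : S.cone [] x = x := rfl

theorem cone_cons (c : A) (w : List A) (x : X) :
    S.cone (c :: w) x = S.branch (c, S.cone w x) := rfl

theorem cone_append (v w : List A) (x : X) : S.cone (v ++ w) x = S.cone v (S.cone w x) :=
  List.foldr_append

theorem smul_cone (τ : Perm A) (w : List A) (x : X) :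
    τ • S.cone w x = S.cone (w.map τ) (τ • x) := by
  induction w with
  | nil => rfl
  | cons c w ih => rw [cone_cons, smul_branch, ih, List.map_cons, cone_cons]

theorem branch_inj {c d : A} {x y : X} (h : S.branch (c, x) = S.branch (d, y)) : c = d ∧ x = y :=
  Prod.mk.inj (S.branch.injective h)

theorem cone_injective (w : List A) : Function.Injective (S.cone w) := by
  induction w with
  | nil => exact Function.injective_id
  | cons c w ih => exact fun _ _ h => ih (S.branch_inj h).2

theorem exists_cone_eq (N : ℕ) (x : X) : ∃ w y, w.length = N ∧ S.cone w y = x := by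
  induction N generalizing x with
  | zero => exact ⟨[], x, rfl, rfl⟩
  | succ N ih =>
    obtain ⟨⟨c, x⟩, rfl⟩ := S.branch.surjective x
    obtain ⟨w, y, rfl, rfl⟩ := ih x
    exact ⟨c :: w, y, rfl, rfl⟩

theorem exists_append_of_cone_eq {v w : List A} {x y : X} (h : S.cone v x = S.cone w y)
    (hl : v.length ≤ w.length) : ∃ t, w = v ++ t ∧ x = S.cone t y := by
  induction v generalizing w with
  | nil => exact ⟨w, rfl, h⟩
  | cons a v ih =>
    cases w with
    | nil => simp at hl
    | cons b w =>
      obtain ⟨rfl, h'⟩ := S.branch_inj h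
      obtain ⟨t, rfl, ht⟩ := ih h' (Nat.le_of_succ_le_succ hl)
      exact ⟨t, rfl, ht⟩

theorem cone_smul_inj [Nontrivial A] [Nonempty X] {q r : List A} {τ σ : Perm A}
    (h : ∀ x, S.cone q (τ • x) = S.cone r (σ • x)) : q = r ∧ τ = σ := by
  wlog hl : q.length ≤ r.length generalizing q r τ σ
  · exact (this (fun x => (h x).symm) (le_of_not_ge hl)).imp Eq.symm Eq.symm
  obtain ⟨x₀⟩ := ‹Nonempty X›
  obtain ⟨t, rfl, -⟩ := S.exists_append_of_cone_eq (h x₀) hl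
  have h_smul : ∀ x, τ • x = S.cone t (σ • x) := fun x =>
    S.cone_injective q ((h x).trans (S.cone_append q t _))
  cases t with
  | nil =>
    refine ⟨(List.append_nil q).symm, Equiv.ext fun c => ?_⟩
    have hc := h_smul (S.branch (c, x₀))
    rw [cone_nil, smul_branch, smul_branch] at hc
    exact (S.branch_inj hc).1
  | cons a t =>
    obtain ⟨b, hb⟩ := exists_ne (τ.symm a)
    have hab := h_smul (S.branch (b, x₀))
    rw [smul_branch] at hab
    exact absurd ((Equiv.eq_symm_apply τ).2 (S.branch_inj hab).1) hb

/-- `f` maps the cone of `w` onto the cone of `q`, acting on the tails through `τ`. -/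
def MapsCone (f : X → X) (w q : List A) (τ : Perm A) : Prop :=
  ∀ x, f (S.cone w x) = S.cone q (τ • x)

variable {S} {f g : X → X} {w w' q q' r : List A} {τ τ' σ : Perm A}

theorem MapsCone.append (h : S.MapsCone f w q τ) (t : List A) :
    S.MapsCone f (w ++ t) (q ++ t.map τ) τ := by
  intro x
  rw [cone_append, h, smul_cone, cone_append]

theorem MapsCone.comp (hg : S.MapsCone g q r σ) (hf : S.MapsCone f w q τ) :
    S.MapsCone (g ∘ f) w r (σ * τ) := by
  intro x
  rw [Function.comp_apply, hf, hg, mul_smul]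

theorem MapsCone.unique [Nontrivial A] [Nonempty X] (h : S.MapsCone f w q τ)
    (h' : S.MapsCone f w q' τ') : q = q' ∧ τ = τ' :=
  S.cone_smul_inj fun x => (h x).symm.trans (h' x)

theorem MapsCone.transfer [Nontrivial A] [Nonempty X] (h : S.MapsCone f w q τ)
    (h' : S.MapsCone f w' q' τ') {y y' : Y} (hy : T.cone w y = T.cone w' y') :
    T.cone q (τ • y) = T.cone q' (τ' • y') := by
  wlog hl : w.length ≤ w'.length generalizing w w' q q' τ τ' y y'
  · exact (this h' h hy.symm (le_of_not_ge hl)).symm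
  obtain ⟨t, rfl, rfl⟩ := T.exists_append_of_cone_eq hy hl
  obtain ⟨rfl, rfl⟩ := (h.append t).unique h'
  rw [smul_cone, cone_append]

end SelfSimilar

section Cantor

variable {n : ℕ} {H : Subgroup (Perm (Letter n))}

theorem cat_head_tail (ζ : Cantor n) : cat [ζ 0] (fun i => ζ (i + 1)) = ζ := by
  funext i
  cases i <;> rfl

/-- The Cantor space as the disjoint union of the sets of words with a given first letter. -/
def cantor (n : ℕ) : SelfSimilar (Letter n) (Cantor n) where
  branch :=
    { toFun p := cat [p.1] p.2
      invFun ζ := (ζ 0, fun i => ζ (i + 1))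
      left_inv _ := rfl
      right_inv := cat_head_tail }
  smul_branch τ c := comp_cat τ [c]

theorem cantor_cone (w : Word n) : (cantor n).cone w = cat w := by
  induction w with
  | nil => rfl
  | cons c w ih =>
    funext u
    rw [SelfSimilar.cone_cons, ih]
    rfl

theorem mapsCone_cantor_iff {f : Cantor n → Cantor n} {w q : Word n} {τ : Perm (Letter n)} :
    (cantor n).MapsCone f w q τ ↔ ∀ u, f (cat w u) = cat q (τ ∘ u) := by
  rw [SelfSimilar.MapsCone, cantor_cone, cantor_cone]
  rfl

theorem continuous_cat (w : Word n) : Continuous (cat w) := by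
  induction w with
  | nil => exact continuous_id
  | cons a w ih =>
    refine continuous_pi fun i => ?_
    cases i with
    | zero => exact continuous_const
    | succ i => exact (continuous_apply i).comp ih

theorem isOpen_range_cat (w : Word n) : IsOpen (Set.range (cat w)) := by
  induction w with
  | nil => exact Function.surjective_id.range_eq ▸ isOpen_univ
  | cons a w ih =>
    have h_eq : Set.range (cat (a :: w)) =
        (fun ζ : Cantor n => ζ 0) ⁻¹' {a} ∩ (fun ζ i => ζ (i + 1)) ⁻¹' Set.range (cat w) := by
      ext ζ
      constructor
      · rintro ⟨u, rfl⟩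
        exact ⟨rfl, u, rfl⟩
      · rintro ⟨rfl, u, hu⟩
        exact ⟨u, (congrArg (cat [ζ 0]) hu).trans (cat_head_tail ζ)⟩
    rw [h_eq]
    exact ((isOpen_discrete {a}).preimage (by fun_prop)).inter (ih.preimage (by fun_prop))

theorem isOpenEmbedding_cat (w : Word n) : Topology.IsOpenEmbedding (cat w) where
  toIsEmbedding := ((continuous_cat w).isClosedEmbedding
    (cantor_cone w ▸ (cantor n).cone_injective w)).isEmbedding
  isOpen_range := isOpen_range_cat w

theorem continuousAt_of_mapsCone {f : Cantor n → Cantor n} {w q : Word n} {τ : Perm (Letter n)}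
    (h : (cantor n).MapsCone f w q τ) {ζ : Cantor n} (hζ : IsPrefixOf w ζ) :
    ContinuousAt f ζ := by
  obtain ⟨u, rfl⟩ := hζ
  rw [← (isOpenEmbedding_cat w).continuousAt_iff,
    show f ∘ cat w = fun u => cat q (τ ∘ u) from funext (mapsCone_cantor_iff.1 h)]
  have hτ : Continuous fun u : Cantor n => τ ∘ u :=
    continuous_pi fun i => continuous_of_discreteTopology.comp (continuous_apply i)
  exact ((continuous_cat q).comp hτ).continuousAt

theorem exists_forall_length_of_forall_exists_prefix [Nonempty (Letter n)] {P : Word n → Prop}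
    (h_append : ∀ w t, P w → P (w ++ t)) (h_prefix : ∀ ζ, ∃ w, P w ∧ IsPrefixOf w ζ) :
    ∃ N : ℕ, ∀ w : Word n, w.length = N → P w := by
  obtain ⟨F, hF⟩ := isCompact_univ.elim_finite_subcover
    (fun w : {w // P w} => Set.range (cat w.1)) (fun w => isOpen_range_cat w.1) fun ζ _ => by
      obtain ⟨w, hw, u, rfl⟩ := h_prefix ζ
      exact Set.mem_iUnion.2 ⟨⟨w, hw⟩, u, rfl⟩
  refine ⟨F.sup fun v => v.1.length, fun w hw => ?_⟩
  let u₀ : Cantor n := Classical.ofNonempty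
  obtain ⟨v, hv, u, hu⟩ := Set.mem_iUnion₂.1 (hF (Set.mem_univ (cat w u₀)))
  obtain ⟨t, rfl⟩ := prefix_of_cat_eq hu (hw ▸ Finset.le_sup (f := fun v => v.1.length) hv)
  exact h_append _ t v.2

theorem mem_V_iff {f : Cantor n ≃ₜ Cantor n} : f ∈ V n H ↔ ∃ N : ℕ,
    ∀ w : Word n, w.length = N → ∃ q, ∃ τ ∈ H, (cantor n).MapsCone f w q τ := by
  simp only [mapsCone_cantor_iff]
  exact describes_iff f

theorem exists_mapsCone_of_le_length (f : V n H) : ∃ N : ℕ, ∀ w : Word n, N ≤ w.length →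
    ∃ q, ∃ τ ∈ H, (cantor n).MapsCone f.1 w q τ := by
  obtain ⟨N, hN⟩ := mem_V_iff.1 f.2
  refine ⟨N, fun w hw => ?_⟩
  obtain ⟨q, τ, hτ, h⟩ := hN (w.take N) (List.length_take_of_le hw)
  exact ⟨_, τ, hτ, List.take_append_drop N w ▸ h.append (w.drop N)⟩

/-- The inclusion of `V_n(H)` into the group of all permutations of the Cantor space. -/
def toPerm : V n H →* Perm (Cantor n) where
  toFun f := f.1.toEquiv
  map_one' := rfl
  map_mul' _ _ := rfl

theorem toPerm_apply (f : V n H) (ζ : Cantor n) : toPerm f ζ = f.1 ζ := rfl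

theorem toPerm_injective : Function.Injective (toPerm (H := H)) :=
  Homeomorph.toEquiv_injective.comp Subtype.val_injective

theorem mem_range_toPerm [Nonempty (Letter n)] {F : Perm (Cantor n)}
    (hF : ∀ ζ, ∃ w, (∃ q, ∃ τ ∈ H, (cantor n).MapsCone F w q τ) ∧ IsPrefixOf w ζ) :
    F ∈ (toPerm (H := H)).range := by
  have h_cont : Continuous F := continuous_iff_continuousAt.2 fun ζ => by
    obtain ⟨w, ⟨q, τ, -, h⟩, hw⟩ := hF ζ
    exact continuousAt_of_mapsCone h hw
  refine ⟨⟨h_cont.homeoOfEquivCompactToT2, mem_V_iff.2 ?_⟩, rfl⟩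
  refine exists_forall_length_of_forall_exists_prefix (fun w t => ?_) hF
  rintro ⟨q, τ, hτ, h⟩
  exact ⟨q ++ t.map τ, τ, hτ, h.append t⟩

theorem exists_mem_V_apply_ne [Nontrivial (Letter n)] (ζ : Cantor n) :
    ∃ g : V n H, g.1 ζ ≠ ζ := by
  obtain ⟨b, hb⟩ := exists_ne (ζ 0)
  let π : Perm (Letter n) := Equiv.swap (ζ 0) b
  let F : Perm (Cantor n) := (cantor n).branch.permCongr (π.prodCongr (Equiv.refl _))
  obtain ⟨g, hg⟩ : F ∈ (toPerm (H := H)).range := mem_range_toPerm fun ξ =>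
    ⟨[ξ 0], ⟨[π (ξ 0)], 1, one_mem H, fun _ => rfl⟩, _, (cat_head_tail ξ).symm⟩
  refine ⟨g, fun h => hb ?_⟩
  calc b = π (ζ 0) := (Equiv.swap_apply_left _ _).symm
    _ = F ζ 0 := rfl
    _ = ζ 0 := by rw [← hg, toPerm_apply, h]

end Cantor

namespace SelfSimilar

variable {m : ℕ} [Nontrivial (Letter m)] {G : Subgroup (Perm (Letter m))}
  {X : Type*} [MulAction (Perm (Letter m)) X] (S : SelfSimilar (Letter m) X)

theorem exists_lift (f : V m G) (x : X) : ∃ y, ∀ w q τ z,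
    (cantor m).MapsCone f.1 w q τ → S.cone w z = x → y = S.cone q (τ • z) := by
  obtain ⟨N, hN⟩ := mem_V_iff.1 f.2
  obtain ⟨w₀, z₀, hw₀, rfl⟩ := S.exists_cone_eq N x
  obtain ⟨q₀, τ₀, -, h₀⟩ := hN w₀ hw₀
  exact ⟨S.cone q₀ (τ₀ • z₀), fun w q τ z h hz => h₀.transfer S h hz.symm⟩

/-- The self-map of `X` induced by an element of `V_m(G)`: it maps cones in the same way. -/
noncomputable def lift (f : V m G) (x : X) : X := (S.exists_lift f x).choose

theorem mapsCone_lift {f : V m G} {w q : Word m} {τ : Perm (Letter m)}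
    (h : (cantor m).MapsCone f.1 w q τ) : S.MapsCone (S.lift f) w q τ := fun x =>
  (S.exists_lift f (S.cone w x)).choose_spec w q τ x h rfl

theorem lift_one : S.lift (1 : V m G) = id :=
  have h : (cantor m).MapsCone (1 : V m G).1 [] [] 1 := fun _ => rfl
  funext fun x => (S.mapsCone_lift h x).trans (one_smul _ x)

theorem lift_mul (g f : V m G) : S.lift (g * f) = S.lift g ∘ S.lift f := by
  funext x
  obtain ⟨M, hM⟩ := exists_mapsCone_of_le_length f
  obtain ⟨N, hN⟩ := exists_mapsCone_of_le_length g
  obtain ⟨w, y, hw, rfl⟩ := S.exists_cone_eq M x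
  obtain ⟨t, z, ht, rfl⟩ := S.exists_cone_eq N y
  obtain ⟨q, τ, -, hf⟩ := hM w hw.ge
  obtain ⟨r, σ, -, hg⟩ := hN (q ++ t.map τ) (by simp [ht])
  have hgf := hg.comp (hf.append t)
  rw [← cone_append, S.mapsCone_lift (f := g * f) hgf z]
  exact (((S.mapsCone_lift hg).comp (S.mapsCone_lift (hf.append t))) z).symm

/-- The action of `V_m(G)` on a self-similar set. -/
noncomputable def liftHom : V m G →* Perm X :=
  MonoidHom.toHomPerm { toFun := S.lift, map_one' := S.lift_one, map_mul' := S.lift_mul }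

theorem mapsCone_liftHom {f : V m G} {w q : Word m} {τ : Perm (Letter m)}
    (h : (cantor m).MapsCone f.1 w q τ) : S.MapsCone (S.liftHom f) w q τ :=
  S.mapsCone_lift h

theorem liftHom_injective [Nonempty X] : Function.Injective (S.liftHom (G := G)) := by
  rw [injective_iff_map_eq_one]
  intro f hf
  obtain ⟨N, hN⟩ := mem_V_iff.1 f.2
  refine Subtype.ext (Homeomorph.ext fun ζ => ?_)
  obtain ⟨w, u, hw, rfl⟩ := (cantor m).exists_cone_eq N ζ
  obtain ⟨q, τ, -, h⟩ := hN w hw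
  have h_one : S.MapsCone (1 : Perm X) w w 1 := fun x => by rw [one_smul, Perm.one_apply]
  obtain ⟨rfl, rfl⟩ := (hf ▸ S.mapsCone_liftHom h).unique h_one
  exact (h u).trans (congrArg _ (one_smul _ u))

end SelfSimilar

section Insertion

variable {m n : ℕ} (ι : Letter m ↪ Letter n)

open scoped Classical in
/-- What the `c`-th branch map of `region ι` makes of the first two letters `b`, `t`: it inserts at
most one letter, so that the result begins with `ι c`. -/
noncomputable def insertWord (c : Letter m) (b t : Letter n) : Word n :=
  if b = ι c then (if t ∈ Set.range ι then [b, t, t] else [b, t]) else [ι c, b, t]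

open scoped Classical in
/-- What the common left inverse of the branch maps of `region ι` makes of the first three
letters. -/
noncomputable def eraseWord (b t s : Letter n) : Word n :=
  if t ∈ Set.range ι then (if s = t then [b, t] else [t, s]) else [b, t, s]

/-- The action of `insertWord` on the beginning of an infinite word. -/
noncomputable def insertLetter (c : Letter m) (ζ : Cantor n) : Cantor n :=
  cat (insertWord ι c (ζ 0) (ζ 1)) fun i => ζ (i + 2)

/-- The action of `eraseWord` on the beginning of an infinite word. -/
noncomputable def eraseLetter (ζ : Cantor n) : Cantor n :=
  cat (eraseWord ι (ζ 0) (ζ 1) (ζ 2)) fun i => ζ (i + 3)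

/-- The clopen part of the Cantor space on which `V_m(G)` is made to act. -/
def region : Set (Cantor n) := {ζ | ζ 0 ∈ Set.range ι ∧ ζ 1 ≠ ζ 0}

variable {ι}

theorem insertLetter_cat (c : Letter m) (b t : Letter n) (w : Word n) (u : Cantor n) :
    insertLetter ι c (cat (b :: t :: w) u) = cat (insertWord ι c b t ++ w) u :=
  (cat_append _ w u).symm

theorem eraseLetter_cat (b t s : Letter n) (w : Word n) (u : Cantor n) :
    eraseLetter ι (cat (b :: t :: s :: w) u) = cat (eraseWord ι b t s ++ w) u :=
  (cat_append _ w u).symm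

theorem insertLetter_zero (c : Letter m) (ζ : Cantor n) : insertLetter ι c ζ 0 = ι c := by
  unfold insertLetter insertWord
  split_ifs with hb
  · exact hb
  · exact hb
  · rfl

theorem insertLetter_mem_region (c : Letter m) {ζ : Cantor n} (hζ : ζ ∈ region ι) :
    insertLetter ι c ζ ∈ region ι := by
  refine ⟨⟨c, (insertLetter_zero c ζ).symm⟩, ?_⟩
  rw [insertLetter_zero]
  unfold insertLetter insertWord
  split_ifs with hb
  · exact hb ▸ hζ.2
  · exact hb ▸ hζ.2
  · exact hb

theorem eraseLetter_mem_region {ζ : Cantor n} (hζ : ζ ∈ region ι) :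
    eraseLetter ι ζ ∈ region ι := by
  unfold eraseLetter eraseWord
  split_ifs with ht hs
  · exact hζ
  · exact ⟨ht, hs⟩
  · exact hζ

theorem cat_mem_region_iff {w : Word n} (hw : 2 ≤ w.length) (u v : Cantor n) :
    cat w u ∈ region ι ↔ cat w v ∈ region ι := by
  match w, hw with
  | _ :: _ :: _, _ => exact Iff.rfl

theorem exists_cat_three (ζ : Cantor n) : ∃ b t s u, ζ = cat [b, t, s] u := by
  obtain ⟨w, hw, u, rfl⟩ := exists_cat 3 ζ
  obtain ⟨b, t, s, rfl⟩ := List.length_eq_three.1 hw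
  exact ⟨b, t, s, u, rfl⟩

theorem eraseLetter_insertLetter (c : Letter m) {ζ : Cantor n} (hζ : ζ ∈ region ι) :
    eraseLetter ι (insertLetter ι c ζ) = ζ := by
  obtain ⟨b, t, s, u, rfl⟩ := exists_cat_three ζ
  obtain ⟨hb : b ∈ Set.range ι, htb : t ≠ b⟩ := hζ
  rw [insertLetter_cat, insertWord]
  split_ifs with hbc ht
  · simp [eraseLetter_cat, eraseWord, ht, -Set.mem_range]
  · simp [eraseLetter_cat, eraseWord, ht, -Set.mem_range]
  · simp [eraseLetter_cat, eraseWord, hb, htb, -Set.mem_range]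

theorem insertLetter_eraseLetter {c : Letter m} {ζ : Cantor n} (hζ : ζ ∈ region ι)
    (hc : ζ 0 = ι c) : insertLetter ι c (eraseLetter ι ζ) = ζ := by
  obtain ⟨b, t, s, u, rfl⟩ := exists_cat_three ζ
  obtain rfl : b = ι c := hc
  obtain ⟨-, htb : t ≠ ι c⟩ := hζ
  rw [eraseLetter_cat, eraseWord]
  split_ifs with ht hst
  · simp [insertLetter_cat, insertWord, ht, hst, -Set.mem_range]
  · simp [insertLetter_cat, insertWord, htb]
  · simp [insertLetter_cat, insertWord, ht, -Set.mem_range]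

theorem viaEmbeddingHom_apply_mem_range_iff (τ : Perm (Letter m)) (t : Letter n) :
    Perm.viaEmbeddingHom ι τ t ∈ Set.range ι ↔ t ∈ Set.range ι := by
  rw [Perm.viaEmbeddingHom_apply]
  by_cases ht : t ∈ Set.range ι
  · obtain ⟨a, rfl⟩ := ht
    exact iff_of_true ⟨τ a, (Perm.viaEmbedding_apply τ ι a).symm⟩ ⟨a, rfl⟩
  · rw [Perm.viaEmbedding_apply_of_notMem τ ι t ht]

theorem map_insertWord (τ : Perm (Letter m)) (c : Letter m) (b t : Letter n) :
    (insertWord ι c b t).map (Perm.viaEmbeddingHom ι τ) =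
      insertWord ι (τ c) (Perm.viaEmbeddingHom ι τ b) (Perm.viaEmbeddingHom ι τ t) := by
  have hc : Perm.viaEmbeddingHom ι τ (ι c) = ι (τ c) := Perm.viaEmbedding_apply τ ι c
  simp only [insertWord, ← hc, EmbeddingLike.apply_eq_iff_eq, viaEmbeddingHom_apply_mem_range_iff]
  split_ifs <;> rfl

theorem comp_insertLetter (τ : Perm (Letter m)) (c : Letter m) (ζ : Cantor n) :
    Perm.viaEmbeddingHom ι τ ∘ insertLetter ι c ζ =
      insertLetter ι (τ c) (Perm.viaEmbeddingHom ι τ ∘ ζ) :=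
  (comp_cat _ _ _).trans (congrArg (cat · _) (map_insertWord τ c (ζ 0) (ζ 1)))

theorem comp_mem_region (τ : Perm (Letter m)) {ζ : Cantor n} (hζ : ζ ∈ region ι) :
    Perm.viaEmbeddingHom ι τ ∘ ζ ∈ region ι :=
  ⟨(viaEmbeddingHom_apply_mem_range_iff τ _).2 hζ.1, (Perm.viaEmbeddingHom ι τ).injective.ne hζ.2⟩

/-- `Sym(m)` acts letter by letter, fixing the letters outside of the range of `ι`. -/
noncomputable instance : MulAction (Perm (Letter m)) (region ι) where
  smul τ ζ := ⟨Perm.viaEmbeddingHom ι τ ∘ ζ, comp_mem_region τ ζ.2⟩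
  one_smul ζ := Subtype.ext (congrArg (fun π : Perm (Letter n) => π ∘ ζ.1) (map_one _))
  mul_smul τ σ ζ := Subtype.ext (congrArg (fun π : Perm (Letter n) => π ∘ ζ.1) (map_mul _ τ σ))

theorem bijective_insertLetter : Function.Bijective fun p : Letter m × region ι =>
    (⟨insertLetter ι p.1 p.2, insertLetter_mem_region p.1 p.2.2⟩ : region ι) := by
  constructor
  · rintro ⟨c, ζ⟩ ⟨d, ξ⟩ h
    have h' : insertLetter ι c ζ = insertLetter ι d ξ := congrArg Subtype.val h
    refine Prod.ext (ι.injective ?_) (Subtype.ext ?_)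
    · exact (insertLetter_zero c ζ.1).symm.trans
        ((congrFun h' 0).trans (insertLetter_zero d ξ.1))
    · exact (eraseLetter_insertLetter c ζ.2).symm.trans
        ((congrArg _ h').trans (eraseLetter_insertLetter d ξ.2))
  · rintro ⟨ζ, hζ⟩
    obtain ⟨c, hc⟩ := hζ.1
    exact ⟨(c, ⟨_, eraseLetter_mem_region hζ⟩), Subtype.ext (insertLetter_eraseLetter hζ hc.symm)⟩

variable (ι) in
/-- The region as the disjoint union of its images under `insertLetter ι c`. -/
noncomputable def regionSelfSimilar : SelfSimilar (Letter m) (region ι) where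
  branch := Equiv.ofBijective _ bijective_insertLetter
  smul_branch τ c ζ := Subtype.ext (comp_insertLetter τ c ζ.1)

theorem exists_cone_cat_eq (v : Word m) {w : Word n} (hw : 2 ≤ w.length) :
    ∃ w' : Word n, 2 ≤ w'.length ∧ ∀ u (h : cat w u ∈ region ι),
      ((regionSelfSimilar ι).cone v ⟨cat w u, h⟩ : Cantor n) = cat w' u := by
  induction v with
  | nil => exact ⟨w, hw, fun _ _ => rfl⟩
  | cons c v ih =>
    obtain ⟨w', hw', h_eq⟩ := ih
    obtain ⟨b, t, w', rfl⟩ : ∃ b t r, w' = b :: t :: r := by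
      match w', hw' with
      | b :: t :: r, _ => exact ⟨b, t, r, rfl⟩
    refine ⟨insertWord ι c b t ++ w', ?_, fun u h => ?_⟩
    · unfold insertWord
      split_ifs <;> simp
    · exact (congrArg (insertLetter ι c) (h_eq u h)).trans (insertLetter_cat c b t w' u)

end Insertion

section Embedding

variable {m n : ℕ} [Nontrivial (Letter m)] (ι : Letter m ↪ Letter n)
  {G : Subgroup (Perm (Letter m))}

theorem nonempty_region : (region ι).Nonempty := by
  obtain ⟨a, b, hab⟩ := exists_pair_ne (Letter m)
  exact ⟨cat [ι a] fun _ => ι b, ⟨a, rfl⟩, fun h => hab (ι.injective h).symm⟩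

open scoped Classical in
/-- The action of `V_m(G)` on the region, extended by the identity. -/
noncomputable def regionHom : V m G →* Perm (Cantor n) :=
  Perm.ofSubtype.comp (regionSelfSimilar ι).liftHom

theorem regionHom_injective : Function.Injective (regionHom ι (G := G)) := by
  classical
  have := (nonempty_region ι).to_subtype
  exact Perm.ofSubtype_injective.comp (regionSelfSimilar ι).liftHom_injective

variable {ι}

theorem regionHom_apply_coe (f : V m G) (ζ : region ι) :
    regionHom ι f ζ = (regionSelfSimilar ι).liftHom f ζ := by
  classical
  exact Perm.ofSubtype_apply_coe _ ζ

theorem regionHom_apply_of_notMem (f : V m G) {ζ : Cantor n} (hζ : ζ ∉ region ι) :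
    regionHom ι f ζ = ζ := by
  classical
  exact Perm.ofSubtype_apply_of_not_mem _ hζ

theorem exists_mapsCone_regionHom_of_mem (f : V m G) {ζ : Cantor n} (hζ : ζ ∈ region ι) :
    ∃ w, (∃ q, ∃ τ ∈ G.map (Perm.viaEmbeddingHom ι),
      (cantor n).MapsCone (regionHom ι f) w q τ) ∧ IsPrefixOf w ζ := by
  obtain ⟨N, hN⟩ := mem_V_iff.1 f.2
  obtain ⟨v, ⟨ξ, hξ⟩, hv, h_eq⟩ := (regionSelfSimilar ι).exists_cone_eq N ⟨ζ, hζ⟩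
  obtain ⟨q, τ, hτ, hf⟩ := hN v hv
  obtain ⟨w, hw, u, rfl⟩ := exists_cat 2 ξ
  obtain ⟨w₁, -, h₁⟩ := exists_cone_cat_eq (ι := ι) v hw.ge
  obtain ⟨w₂, -, h₂⟩ := exists_cone_cat_eq (ι := ι) q
    (w := w.map (Perm.viaEmbeddingHom ι τ)) (by rw [List.length_map, hw])
  refine ⟨w₁, ⟨w₂, _, ⟨τ, hτ, rfl⟩, mapsCone_cantor_iff.2 fun z => ?_⟩, u, ?_⟩
  · have hz : cat w z ∈ region ι := (cat_mem_region_iff hw.ge u z).1 hξ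
    have hτz := comp_mem_region τ hz
    rw [comp_cat] at hτz
    calc regionHom ι f (cat w₁ z)
        = regionHom ι f ((regionSelfSimilar ι).cone v ⟨cat w z, hz⟩) := by rw [h₁]
      _ = (regionSelfSimilar ι).cone q (τ • ⟨cat w z, hz⟩) := by
        rw [regionHom_apply_coe, SelfSimilar.mapsCone_liftHom _ hf]
      _ = (regionSelfSimilar ι).cone q ⟨_, hτz⟩ :=
        congrArg (fun x => ((regionSelfSimilar ι).cone q x : Cantor n))
          (Subtype.ext (comp_cat _ w z))
      _ = cat w₂ (Perm.viaEmbeddingHom ι τ ∘ z) := h₂ _ hτz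
  · exact (congrArg Subtype.val h_eq).symm.trans (h₁ u hξ)

theorem exists_mapsCone_regionHom_of_notMem (f : V m G) {ζ : Cantor n} (hζ : ζ ∉ region ι) :
    ∃ w, (∃ q, ∃ τ ∈ G.map (Perm.viaEmbeddingHom ι),
      (cantor n).MapsCone (regionHom ι f) w q τ) ∧ IsPrefixOf w ζ := by
  obtain ⟨w, hw, u, rfl⟩ := exists_cat 2 ζ
  refine ⟨w, ⟨w, 1, one_mem _, mapsCone_cantor_iff.2 fun z => ?_⟩, u, rfl⟩
  exact regionHom_apply_of_notMem f fun hz => hζ ((cat_mem_region_iff hw.ge u z).2 hz)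

theorem regionHom_mem_range_toPerm (f : V m G) :
    regionHom ι f ∈ (toPerm (H := G.map (Perm.viaEmbeddingHom ι))).range :=
  have : Nonempty (Letter n) := .map ι inferInstance
  mem_range_toPerm fun ζ => (em (ζ ∈ region ι)).elim
    (exists_mapsCone_regionHom_of_mem f) (exists_mapsCone_regionHom_of_notMem f)

variable (ι) in
/-- `regionHom` as a homomorphism between symmetric Thompson groups. -/
noncomputable def embedding : V m G →* V n (G.map (Perm.viaEmbeddingHom ι)) :=
  (MonoidHom.ofInjective toPerm_injective).symm.toMonoidHom.comp
    ((regionHom ι).codRestrict toPerm.range regionHom_mem_range_toPerm)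

theorem toPerm_embedding (f : V m G) : toPerm (embedding ι f) = regionHom ι f :=
  MonoidHom.apply_ofInjective_symm toPerm_injective _

theorem embedding_injective : Function.Injective (embedding ι (G := G)) := fun f g h =>
  regionHom_injective ι (by rw [← toPerm_embedding, h, toPerm_embedding])

theorem exists_forall_embedding_apply_eq : ∃ ζ : Cantor n, ∀ f : V m G, (embedding ι f).1 ζ = ζ :=
  let a : Letter m := Classical.ofNonempty
  ⟨fun _ => ι a, fun f => by
    rw [← toPerm_apply, toPerm_embedding, regionHom_apply_of_notMem f fun h => h.2 rfl]⟩

end Embedding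

end SymThompson

theorem theorem1p2_general {m n : ℕ} (hm : 2 ≤ m) (ι : SymThompson.Letter m ↪ SymThompson.Letter n)
    (G : Subgroup (Equiv.Perm (SymThompson.Letter m))) :
    ∃ φ : SymThompson.V m G →* SymThompson.V n (G.map (Equiv.Perm.viaEmbeddingHom ι)),
      Function.Injective φ ∧
      ¬ ∃ h : SymThompson.Cantor m ≃ₜ SymThompson.Cantor n,
        ∀ (g : SymThompson.V m G) (ζ : SymThompson.Cantor m),
          (φ g : SymThompson.Cantor n ≃ₜ SymThompson.Cantor n) (h ζ) =
            h ((g : SymThompson.Cantor m ≃ₜ SymThompson.Cantor m) ζ) := by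
  have := Fin.nontrivial_iff_two_le.2 hm
  refine ⟨SymThompson.embedding ι, SymThompson.embedding_injective, fun ⟨h, h_conj⟩ => ?_⟩
  obtain ⟨ζ, hζ⟩ := SymThompson.exists_forall_embedding_apply_eq (ι := ι) (G := G)
  obtain ⟨g, hg⟩ := SymThompson.exists_mem_V_apply_ne (H := G) (h.symm ζ)
  have h_fix := h_conj g (h.symm ζ)
  rw [h.apply_symm_apply, hζ g] at h_fix
  exact hg (h.symm_apply_eq.2 h_fix).symm

theorem theorem1p2 (m n k : ℕ) (hm : 2 ≤ m) (hk : 1 ≤ k) (hn : n = k * (m - 1) + m)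
    (G : Subgroup (Equiv.Perm (SymThompson.Letter m))) :
    ∃ φ : SymThompson.V m G →*
        SymThompson.V n (SymThompson.extGroup (hn.symm ▸ Nat.le_add_left m (k * (m - 1)) : m ≤ n) G),
      Function.Injective φ ∧
      ¬ ∃ h : SymThompson.Cantor m ≃ₜ SymThompson.Cantor n,
        ∀ (g : SymThompson.V m G) (ζ : SymThompson.Cantor m),
          (φ g : SymThompson.Cantor n ≃ₜ SymThompson.Cantor n) (h ζ) =
            h ((g : SymThompson.Cantor m ≃ₜ SymThompson.Cantor m) ζ) := by
  exact theorem1p2_general hm (Fin.castLEEmb _) G
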